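/- A (nondegenerate) cycle set is a set $X$ with a binary operation $\ast$ such that for every $x \in X$ the map $\sigma_x : X \to X$, $y \mapsto x \ast y$, is bijective; $(x \ast y)\ast(x \ast z) = (y \ast x)\ast(y \ast z)$ for all $x,y,z \in X$; and the diagonal map $T : X \to X$, $x \mapsto x \ast x$, is bijective. The cycle set $X$ is called retractable if there are distinct $x,y \in X$ with $\sigma_x = \sigma_y$. Theorem. Let $X$ be a finite nondegenerate cycle set of size $n = 2^v$, where $v > 2$. If the diagonal map $T$ of $X$ is an $n$-cycle (that is, a single cycle through all elements of $X$), then $X$ is retractable. -/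

import Mathlib

/-- A nondegenerate cycle set: a set with a binary operation `x ∗ y` such that all left translations
`y ↦ x ∗ y` are bijective, the cycloid equation holds, and `x ↦ x ∗ x` is bijective. -/
class CycleSet (X : Type*) where
  /-- the operation `x ∗ y` -/
  op : X → X → X
  bijective_op : ∀ x : X, Function.Bijective (op x)
  cycloid : ∀ x y z : X, op (op x y) (op x z) = op (op y x) (op y z)
  bijective_diag : Function.Bijective (fun x : X => op x x)

namespace CycleSet

/-- The permutation `σ_x : y ↦ x ∗ y`. -/
noncomputable def sigma {X : Type*} [CycleSet X] (x : X) : Equiv.Perm X :=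
  Equiv.ofBijective (op x) (bijective_op x)

/-- The diagonal map `T : x ↦ x ∗ x`, as a permutation of `X`. -/
noncomputable def diagonal (X : Type*) [CycleSet X] : Equiv.Perm X :=
  Equiv.ofBijective (fun x : X => op x x) bijective_diag

/-- The retraction relation `x ∼ y ↔ σ_x = σ_y`. -/
noncomputable def retractionSetoid (X : Type*) [CycleSet X] : Setoid X :=
  Setoid.ker (fun x : X => sigma x)

/-- A cycle set is retractable if its retraction relation is nontrivial,
that is, different from equality. -/
def IsRetractable (X : Type*) [CycleSet X] : Prop :=
  retractionSetoid X ≠ ⊥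

theorem isRetractable_iff {X : Type*} [CycleSet X] :
    IsRetractable X ↔ ∃ x y : X, x ≠ y ∧ ∀ z : X, op x z = op y z := by
  unfold IsRetractable
  rw [Ne, ← le_bot_iff, Setoid.le_def]
  push Not
  constructor
  · rintro ⟨x, y, h, hne⟩
    exact ⟨x, y, hne, fun z => DFunLike.congr_fun (show sigma x = sigma y from h) z⟩
  · rintro ⟨x, y, hne, h⟩
    exact ⟨x, y, show sigma x = sigma y from Equiv.ext h, hne⟩

end CycleSet

/-! Label `X` by `ZMod (2 ^ v)` so that the diagonal is `x ↦ x + 1`, and put `h = 2 ^ (v - 1)`. The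
group `G` generated by the `s x` carries a second, commutative addition (a brace), modelled by
`Brace` and `toPerm`. Any left ideal of odd order has orbits of one common odd size dividing `2 ^
v`, so it is trivial and `G` is a 2-group (`isPGroup_two`). Hence the brace has a `G`-fixed element
of order two, and this acts as translation by `h` (`toPerm_fixed`). Commutativity of addition then
gives `s (x + h) (y + h) = s x y + h`, so it suffices that every `s y` commutes with translation by
`h`: then `s (x + h) = s x`.

A central involution `κ` of `G` is affine without fixed points, so it is either that translation,
and the proof is over, or a reflection `x ↦ j - x` with `j` odd (`affine_involution`). In the
reflection case, a central involution of `G` modulo the kernel of its action on the pairs `{x, j -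
x}` is again forced to be translation by `h` up to reflection (`exists_pairing`, `IsPairing.half`).
Elements of `G` thus commute with this translation up to reflection, and a brace computation removes
the ambiguity for the `s y` (`half_commutes_of_reflection`). -/

namespace CycleSet

open Equiv

/-! ### The brace structure on the permutation group. -/

section Brace

variable {X : Type*} (s : X → Perm X)

/-- The cycloid equation for a family of permutations. -/
def IsCycloid : Prop := ∀ x y, s (s x y) * s x = s (s y x) * s y

variable {s}

/-- This independence of order is what lets a product of twisted `s x` be indexed by a multiset. -/
theorem IsCycloid.rightCommutative (hs : IsCycloid s) :
    RightCommutative (fun (g : Perm X) (x : X) => s (g x) * g) :=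
  ⟨fun g x y => by simpa [mul_assoc] using congrArg (· * g) (hs (g x) (g y))⟩

variable (hs : IsCycloid s)

/-- The permutation by which a multiset of elements of a cycle set acts. -/
def IsCycloid.msetPerm (m : Multiset X) : Perm X :=
  haveI := hs.rightCommutative
  m.foldl (fun g x => s (g x) * g) 1

theorem IsCycloid.foldl_eq (g : Perm X) (m : Multiset X) :
    haveI := hs.rightCommutative
    m.foldl (fun g x => s (g x) * g) g = hs.msetPerm (m.map g) * g := by
  have := hs.rightCommutative
  have key : ∀ (l : Multiset X) (g k : Perm X),
      l.foldl (fun g x => s (g x) * g) (k * g) =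
        (l.map g).foldl (fun g x => s (g x) * g) k * g := by
    intro l
    induction l using Multiset.induction with
    | empty => intro g k; simp
    | cons a l ih =>
      intro g k
      simp only [Multiset.foldl_cons, Multiset.map_cons]
      rw [← ih]
      simp [mul_assoc]
  have := key m g 1
  rw [one_mul] at this
  exact this

@[simp] theorem IsCycloid.msetPerm_zero : hs.msetPerm 0 = 1 := by
  simp [IsCycloid.msetPerm]

@[simp] theorem IsCycloid.msetPerm_singleton (x : X) : hs.msetPerm {x} = s x := by
  have := hs.rightCommutative
  have := Multiset.foldl_cons (fun (g : Perm X) (x : X) => s (g x) * g) 1 x 0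
  simpa [IsCycloid.msetPerm] using this

theorem IsCycloid.msetPerm_add (m m' : Multiset X) :
    hs.msetPerm (m + m') = hs.msetPerm (m'.map (hs.msetPerm m)) * hs.msetPerm m := by
  have := hs.rightCommutative
  rw [← hs.foldl_eq]
  exact Multiset.foldl_add _ _ _ _

theorem IsCycloid.msetPerm_mul (m m' : Multiset X) :
    hs.msetPerm m' * hs.msetPerm m =
      hs.msetPerm (m + m'.map ((hs.msetPerm m)⁻¹ : Perm X)) := by
  rw [hs.msetPerm_add, Multiset.map_map]
  congr 2
  conv_lhs => rw [← Multiset.map_id m']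
  refine Multiset.map_congr rfl fun x _ => ?_
  simp

/-- The permutation group of a finite cycle set. -/
def IsCycloid.permGroup [Finite X] : Subgroup (Perm X) :=

  {
      carrier := Set.range hs.msetPerm
      mul_mem' := by
        rintro _ _ ⟨m, rfl⟩ ⟨m', rfl⟩
        exact ⟨_, (hs.msetPerm_mul m' m).symm⟩
      one_mem' := ⟨0, hs.msetPerm_zero⟩
      inv_mem' := by
        rintro _ ⟨m, rfl⟩
        have hpow : ∀ k : ℕ, ∃ m', hs.msetPerm m' = hs.msetPerm m ^ k := by
          intro k
          induction k with
          | zero => exact ⟨0, by simp⟩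
          | succ k ih =>
            obtain ⟨m', hm'⟩ := ih
            exact ⟨_, by rw [pow_succ, ← hm', hs.msetPerm_mul]⟩
        obtain ⟨m', hm'⟩ := hpow (orderOf (hs.msetPerm m) - 1)
        refine ⟨m', hm'.trans (eq_inv_of_mul_eq_one_left ?_)⟩
        rw [← pow_succ, Nat.sub_add_cancel (orderOf_pos _), pow_orderOf_eq_one] }

variable [Finite X]

/-- Write `g = msetPerm k` and expand `k + m` in both orders: one expansion involves `m` only
through `msetPerm m`. Both the sum and the action descend to the quotient because of this. -/
theorem IsCycloid.msetPerm_map_congr {m m' : Multiset X}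
    (h : hs.msetPerm m = hs.msetPerm m') {g : Perm X} (hg : g ∈ hs.permGroup) :
    hs.msetPerm (m.map g) = hs.msetPerm (m'.map g) := by
  obtain ⟨k, rfl⟩ := hg
  have h1 := hs.msetPerm_add k m
  have h2 := hs.msetPerm_add k m'
  rw [add_comm, hs.msetPerm_add, h, ← hs.msetPerm_add, add_comm, h2] at h1
  exact (mul_right_cancel h1).symm

/-- Two multisets are identified if they act by the same permutation. -/
def IsCycloid.con : AddCon (Multiset X) where
  r m m' := hs.msetPerm m = hs.msetPerm m'
  iseqv := ⟨fun _ => rfl, Eq.symm, Eq.trans⟩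
  add' := by
    intro a b c d hab hcd
    rw [hs.msetPerm_add, hs.msetPerm_add, hab,
      hs.msetPerm_map_congr hcd ⟨b, rfl⟩]

/-- The additive group of the permutation brace of a finite cycle set. -/
abbrev IsCycloid.Brace : Type _ := hs.con.Quotient

theorem IsCycloid.con_iff {m m' : Multiset X} :
    (m : hs.Brace) = (m' : hs.Brace) ↔ hs.msetPerm m = hs.msetPerm m' :=
  AddCon.eq hs.con

/-- The identification of the brace with the permutation group. -/
def IsCycloid.toPerm (a : hs.Brace) : hs.permGroup :=
  AddCon.liftOn a (fun m => ⟨hs.msetPerm m, m, rfl⟩) fun _ _ h => Subtype.ext h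

@[simp] theorem IsCycloid.coe_toPerm (m : Multiset X) :
    (hs.toPerm (m : hs.Brace) : Perm X) = hs.msetPerm m := rfl

theorem IsCycloid.toPerm_bijective : Function.Bijective hs.toPerm := by
  constructor
  · intro a b
    induction a using AddCon.induction_on with | _ m =>
    induction b using AddCon.induction_on with | _ m' =>
    intro h
    exact hs.con_iff.2 (congrArg Subtype.val h)
  · rintro ⟨_, m, rfl⟩
    exact ⟨m, rfl⟩

instance : MulAction hs.permGroup hs.Brace where
  smul g a := AddCon.liftOn a (fun m => ((m.map g.1 : Multiset X) : hs.Brace))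
    fun _ _ h => hs.con_iff.2 (hs.msetPerm_map_congr h g.2)
  one_smul a := by
    induction a using AddCon.induction_on with | _ m =>
    change ((m.map ((1 : hs.permGroup) : Perm X) : Multiset X) : hs.Brace) = _
    simp
  mul_smul g k a := by
    induction a using AddCon.induction_on with | _ m =>
    change ((m.map ((g * k : hs.permGroup) : Perm X) : Multiset X) : hs.Brace) =
      (((m.map k.1).map g.1 : Multiset X) : hs.Brace)
    rw [Multiset.map_map]
    rfl

theorem IsCycloid.smul_coe (g : hs.permGroup) (m : Multiset X) :
    g • (m : hs.Brace) = ((m.map g.1 : Multiset X) : hs.Brace) := rfl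

instance : DistribMulAction hs.permGroup hs.Brace where
  smul_zero g := by
    change g • ((0 : Multiset X) : hs.Brace) = _
    rw [hs.smul_coe]
    simp
  smul_add g a b := by
    induction a using AddCon.induction_on with | _ m =>
    induction b using AddCon.induction_on with | _ m' =>
    rw [← AddCon.coe_add, hs.smul_coe, Multiset.map_add, AddCon.coe_add]
    rfl

theorem IsCycloid.toPerm_add (a b : hs.Brace) :
    hs.toPerm (a + b) = hs.toPerm (hs.toPerm a • b) * hs.toPerm a := by
  induction a using AddCon.induction_on with | _ m =>
  induction b using AddCon.induction_on with | _ m' =>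
  rw [← AddCon.coe_add]
  exact Subtype.ext (hs.msetPerm_add m m')

theorem IsCycloid.exists_add_eq_zero (a : hs.Brace) : ∃ b : hs.Brace, b + a = 0 := by
  obtain ⟨c, hc⟩ := hs.toPerm_bijective.2 (hs.toPerm a)⁻¹
  refine ⟨(hs.toPerm a)⁻¹ • c, hs.toPerm_bijective.1 ?_⟩
  rw [add_comm, hs.toPerm_add, smul_inv_smul, hc, inv_mul_cancel]
  exact Subtype.ext hs.msetPerm_zero.symm

noncomputable instance : Neg hs.Brace := ⟨fun a => (hs.exists_add_eq_zero a).choose⟩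

noncomputable instance : AddCommGroup hs.Brace where
  __ := (inferInstance : AddCommMonoid hs.Brace)
  zsmul := zsmulRec
  neg_add_cancel a := (hs.exists_add_eq_zero a).choose_spec

instance : Finite hs.Brace := Finite.of_injective _ hs.toPerm_bijective.1

/-- The generator of the brace given by an element of the cycle set. -/
def IsCycloid.gen (x : X) : hs.Brace := (({x} : Multiset X) : hs.Brace)

@[simp] theorem IsCycloid.coe_toPerm_gen (x : X) : (hs.toPerm (hs.gen x) : Perm X) = s x :=
  hs.msetPerm_singleton x

theorem IsCycloid.smul_gen (g : hs.permGroup) (x : X) : g • hs.gen x = hs.gen (g.1 x) := by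
  unfold IsCycloid.gen
  rw [hs.smul_coe, Multiset.map_singleton]

end Brace

/-! ### The permutation group is a 2-group. -/

section PGroup

variable {X : Type*} {s : X → Perm X} (hs : IsCycloid s) [Finite X]

theorem IsCycloid.toPerm_zero : hs.toPerm 0 = 1 := Subtype.ext hs.msetPerm_zero

theorem IsCycloid.toPerm_add_comm (a b : hs.Brace) :
    hs.toPerm (hs.toPerm a • b) * hs.toPerm a = hs.toPerm (hs.toPerm b • a) * hs.toPerm b := by
  rw [← hs.toPerm_add, ← hs.toPerm_add, add_comm]

theorem IsCycloid.mul_toPerm (a b : hs.Brace) :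
    hs.toPerm b * hs.toPerm a = hs.toPerm (a + (hs.toPerm a)⁻¹ • b) := by
  rw [hs.toPerm_add, smul_inv_smul]

/-- An invariant subgroup of the brace gives a subgroup of the permutation group. -/
def IsCycloid.leftIdeal (L : AddSubgroup hs.Brace)
    (hL : ∀ (g : hs.permGroup), ∀ a ∈ L, g • a ∈ L) : Subgroup hs.permGroup where
  carrier := hs.toPerm '' L
  mul_mem' := by
    rintro _ _ ⟨a, ha, rfl⟩ ⟨b, hb, rfl⟩
    exact ⟨_, L.add_mem hb (hL _ _ ha), (hs.mul_toPerm b a).symm⟩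
  one_mem' := ⟨0, L.zero_mem, hs.toPerm_zero⟩
  inv_mem' := by
    rintro _ ⟨a, ha, rfl⟩
    refine ⟨-(hs.toPerm a • a), L.neg_mem (hL _ _ ha), eq_inv_of_mul_eq_one_left ?_⟩
    rw [hs.mul_toPerm, smul_neg, inv_smul_smul, add_neg_cancel, hs.toPerm_zero]

/-- Orbits of left ideals are permuted by the diagonal map. -/
theorem IsCycloid.diag_smul (a : hs.Brace) (x : X) :
    s ((hs.toPerm a : Perm X) x) ((hs.toPerm a : Perm X) x) =
      (hs.toPerm (hs.toPerm (hs.gen x) • a) : Perm X) (s x x) := by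
  have h := congrArg (fun g : hs.permGroup => (g : Perm X) x) (hs.toPerm_add_comm a (hs.gen x))
  simpa [hs.smul_gen] using h

/-- `T` embeds the orbit of `x` into that of `T x`, so orbit sizes do not decrease along the cycle,
which returns to its start. -/
theorem card_orbit_eq_of_cycle {H : Type*} [Group H] [MulAction H X] (T : Perm X)
    (hT : T.IsCycleOn Set.univ)
    (hH : ∀ x, ∀ h : H, ∃ h' : H, T (h • x) = h' • T x) (x y : X) :
    Nat.card (MulAction.orbit H x) = Nat.card (MulAction.orbit H y) := by
  have hle : ∀ x, Nat.card (MulAction.orbit H x) ≤ Nat.card (MulAction.orbit H (T x)) := by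
    intro x
    have hmem : ∀ z : MulAction.orbit H x, T z.1 ∈ MulAction.orbit H (T x) := by
      rintro ⟨_, h, rfl⟩
      obtain ⟨h', hh'⟩ := hH x h
      exact ⟨h', hh'.symm⟩
    exact Nat.card_le_card_of_injective (fun z => (⟨T z.1, hmem z⟩ : MulAction.orbit H (T x)))
      fun _ _ hab => Subtype.ext (T.injective (congrArg Subtype.val hab))
  have hpow : ∀ (k : ℕ) x,
      Nat.card (MulAction.orbit H x) ≤ Nat.card (MulAction.orbit H ((T ^ k) x)) := by
    intro k
    induction k with
    | zero => intro x; simp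
    | succ k ih => intro x; rw [pow_succ', Perm.mul_apply]; exact (ih x).trans (hle _)
  have hall : ∀ x y : X, Nat.card (MulAction.orbit H x) ≤ Nat.card (MulAction.orbit H y) := by
    intro x y
    obtain ⟨k, hk⟩ := Perm.SameCycle.exists_pow_eq' (hT.2 (Set.mem_univ x) (Set.mem_univ y))
    rw [← hk.2]
    exact hpow k x
  exact le_antisymm (hall x y) (hall y x)

/-- The common orbit size divides both `Nat.card X` and `Nat.card H`. -/
theorem smul_eq_self_of_coprime_card {H : Type*} [Group H] [MulAction H X] [Finite H] (T : Perm X)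
    (hT : T.IsCycleOn Set.univ)
    (hH : ∀ x, ∀ h : H, ∃ h' : H, T (h • x) = h' • T x)
    (hco : (Nat.card X).Coprime (Nat.card H)) (h : H) (x : X) : h • x = x := by
  have hdvd : Nat.card (MulAction.orbit H x) ∣ Nat.card X := by
    have := Fintype.ofFinite (MulAction.orbitRel.Quotient H X)
    rw [Nat.card_congr (MulAction.selfEquivSigmaOrbits H X), Nat.card_sigma]
    exact Finset.dvd_sum fun ω _ => (card_orbit_eq_of_cycle T hT hH x ω.out).dvd
  have hdvd' : Nat.card (MulAction.orbit H x) ∣ Nat.card H := by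
    rw [Nat.card_congr (MulAction.orbitEquivQuotientStabilizer H x)]
    exact Subgroup.card_quotient_dvd_card _
  have hone := Nat.eq_one_of_dvd_coprimes hco hdvd hdvd'
  have hsub := (Nat.card_eq_one_iff_unique.1 hone).1
  exact congrArg Subtype.val (hsub.elim ⟨h • x, MulAction.mem_orbit x h⟩
    ⟨x, MulAction.mem_orbit_self x⟩)

theorem IsCycloid.isPGroup_two {v : ℕ} (hcard : Nat.card X = 2 ^ v) (T : Perm X)
    (hT : T.IsCycleOn Set.univ) (hTs : ∀ x, T x = s x x) : IsPGroup 2 hs.permGroup := by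
  rw [IsPGroup.iff_card, ← Nat.card_congr (Equiv.ofBijective _ hs.toPerm_bijective)]
  obtain h | ⟨q, hq, hqdvd, hodd⟩ := Nat.eq_two_pow_or_exists_odd_prime_and_dvd (Nat.card hs.Brace)
  · exact h
  exfalso
  have : Fact q.Prime := ⟨hq⟩
  obtain ⟨a, ha⟩ := exists_prime_addOrderOf_dvd_card' q hqdvd
  -- The `q`-torsion is stable under every additive automorphism, hence a left ideal, and its order
  -- is odd.
  let L : AddSubgroup hs.Brace := (nsmulAddMonoidHom q : hs.Brace →+ hs.Brace).ker
  have hmem : ∀ b, b ∈ L ↔ q • b = 0 := fun b => Iff.rfl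
  have hL : ∀ (g : hs.permGroup), ∀ b ∈ L, g • b ∈ L := by
    intro g b hb
    rw [hmem] at hb ⊢
    rw [← smul_comm, hb, smul_zero]
  have hcardL : ¬ 2 ∣ Nat.card L := by
    intro h
    obtain ⟨b, hb⟩ := exists_prime_addOrderOf_dvd_card' 2 h
    have h2 : addOrderOf b ∣ q := addOrderOf_dvd_of_nsmul_eq_zero (Subtype.ext (by
      simpa using (hmem b.1).1 b.2))
    rw [hb] at h2
    exact (Nat.not_even_iff_odd.2 hodd) (even_iff_two_dvd.2 h2)
  have hcardH : Nat.card (hs.leftIdeal L hL) = Nat.card L :=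
    (Nat.card_congr (Equiv.Set.image _ (L : Set hs.Brace) hs.toPerm_bijective.1)).symm
  have htriv := smul_eq_self_of_coprime_card (X := X) (H := hs.leftIdeal L hL) T hT (by
    rintro x ⟨_, b, hb, rfl⟩
    refine ⟨⟨_, _, hL (hs.toPerm (hs.gen x)) b hb, rfl⟩, ?_⟩
    rw [hTs, hTs]
    exact hs.diag_smul b x) (by
    rw [hcard, hcardH]
    exact Nat.Coprime.pow_left _ ((Nat.Prime.coprime_iff_not_dvd Nat.prime_two).2 hcardL))
  have hpa : hs.toPerm a = 1 := by
    refine Subtype.ext (Equiv.ext fun x => ?_)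
    exact htriv ⟨hs.toPerm a, a, (hmem a).2 (ha ▸ addOrderOf_nsmul_eq_zero a), rfl⟩ x
  have ha0 : a = 0 := hs.toPerm_bijective.1 (hpa.trans hs.toPerm_zero.symm)
  rw [ha0, addOrderOf_zero] at ha
  exact hq.one_lt.ne ha

/-- A 2-group acting on a set of even size that fixes `0` fixes another point; a suitable multiple
of it has order two and is still fixed. -/
theorem IsCycloid.exists_fixed (h2 : IsPGroup 2 hs.permGroup) (hne : ∃ x, s x ≠ 1) :
    ∃ z : hs.Brace, z ≠ 0 ∧ z + z = 0 ∧ ∀ g : hs.permGroup, g • z = z := by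
  obtain ⟨k, hk⟩ := (IsPGroup.iff_card).1 h2
  rw [← Nat.card_congr (Equiv.ofBijective _ hs.toPerm_bijective)] at hk
  have hdvd : 2 ∣ Nat.card hs.Brace := by
    rw [hk]
    refine dvd_pow_self 2 ?_
    rintro rfl
    obtain ⟨x, hx⟩ := hne
    rw [pow_zero] at hk
    have := (Nat.card_eq_one_iff_unique.1 hk).1
    apply hx
    rw [← hs.coe_toPerm_gen, Subsingleton.elim (hs.gen x) 0, hs.toPerm_zero]
    rfl
  have h0 : (0 : hs.Brace) ∈ MulAction.fixedPoints hs.permGroup hs.Brace := fun g => smul_zero g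
  obtain ⟨b, hb, hb0⟩ := h2.exists_fixed_point_of_prime_dvd_card_of_fixed_point hs.Brace hdvd h0
  obtain ⟨m, -, hm⟩ := (Nat.dvd_prime_pow Nat.prime_two).1 (hk ▸ addOrderOf_dvd_natCard b)
  cases m with
  | zero => exact absurd (AddMonoid.addOrderOf_eq_one_iff.1 hm) hb0.symm
  | succ m =>
    refine ⟨2 ^ m • b, fun h => ?_, ?_, fun g => ?_⟩
    · have := addOrderOf_dvd_of_nsmul_eq_zero h
      rw [hm] at this
      exact absurd (Nat.le_of_dvd (by positivity) this) (by simp [pow_succ])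
    · rw [← add_nsmul, ← two_mul, ← pow_succ', ← hm, addOrderOf_nsmul_eq_zero]
    · rw [smul_comm, hb g]

end PGroup

/-! ### Arithmetic and affine maps modulo `2 ^ v`. -/

section ZMod

theorem zmod_induction {n : ℕ} [NeZero n] {p : ZMod n → Prop} (h0 : p 0)
    (hsucc : ∀ x, p x → p (x + 1)) (x : ZMod n) : p x := by
  rw [← ZMod.natCast_zmod_val x]
  induction x.val with
  | zero => simpa using h0
  | succ m ih => simpa using hsucc _ ih

variable {v : ℕ}

theorem even_or_odd_zmod (x : ZMod (2 ^ v)) : ∃ y, x = 2 * y ∨ x = 2 * y + 1 := by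
  obtain ⟨m, hm⟩ := Nat.even_or_odd' x.val
  refine ⟨m, hm.imp (fun h => ?_) fun h => ?_⟩ <;>
  · rw [← ZMod.natCast_zmod_val x, h]
    push_cast
    rfl

theorem isNilpotent_two_mul (y : ZMod (2 ^ v)) : IsNilpotent (2 * y) := by
  refine ⟨v, ?_⟩
  have : ((2 ^ v : ℕ) : ZMod (2 ^ v)) = 0 := ZMod.natCast_self _
  push_cast at this
  rw [mul_pow, this, zero_mul]

theorem isUnit_two_mul_add_one (y : ZMod (2 ^ v)) : IsUnit (2 * y + 1) :=
  (isNilpotent_two_mul y).isUnit_add_one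

theorem two_mul_eq_zero_zmod (hv : 0 < v) (c : ZMod (2 ^ v)) :
    2 * c = 0 ↔ c = 0 ∨ c = 2 ^ (v - 1) := by
  obtain ⟨w, rfl⟩ : ∃ w, v = w + 1 := ⟨v - 1, by omega⟩
  have h2 : (2 : ZMod (2 ^ (w + 1))) ^ (w + 1) = 0 := by
    have : ((2 ^ (w + 1) : ℕ) : ZMod (2 ^ (w + 1))) = 0 := ZMod.natCast_self _
    exact_mod_cast this
  constructor
  · intro h
    have hc : ((2 * c.val : ℕ) : ZMod (2 ^ (w + 1))) = 0 := by
      push_cast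
      rwa [ZMod.natCast_zmod_val]
    rw [ZMod.natCast_eq_zero_iff] at hc
    obtain ⟨t, ht⟩ := hc
    replace ht : c.val = 2 ^ w * t :=
      Nat.eq_of_mul_eq_mul_left two_pos (by rw [ht, pow_succ', mul_assoc])
    have hlt : c.val < 2 ^ w * 2 := (ZMod.val_lt c).trans_eq (pow_succ 2 w)
    rw [ht] at hlt
    have ht2 : t < 2 := Nat.lt_of_mul_lt_mul_left hlt
    rw [← ZMod.natCast_zmod_val c, ht]
    interval_cases t
    · left; simp
    · right; simp
  · rintro (rfl | rfl)
    · simp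
    · rw [add_tsub_cancel_right, ← pow_succ', h2]

theorem half_ne_zero (hv : 0 < v) : (2 : ZMod (2 ^ v)) ^ (v - 1) ≠ 0 := by
  intro h
  have h' : ((2 ^ (v - 1) : ℕ) : ZMod (2 ^ v)) = 0 := by exact_mod_cast h
  rw [ZMod.natCast_eq_zero_iff, Nat.pow_dvd_pow_iff_le_right (by norm_num)] at h'
  omega

theorem nontrivial_zmod (hv : 0 < v) : Nontrivial (ZMod (2 ^ v)) :=
  ⟨⟨_, _, half_ne_zero hv⟩⟩

theorem four_ne_zero_zmod (hv : 2 < v) : (4 : ZMod (2 ^ v)) ≠ 0 := by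
  intro h
  have h' : ((2 ^ 2 : ℕ) : ZMod (2 ^ v)) = 0 := by push_cast; rw [← h]
  rw [ZMod.natCast_eq_zero_iff, Nat.pow_dvd_pow_iff_le_right (by norm_num)] at h'
  omega

theorem two_ne_zero_zmod (hv : 2 < v) : (2 : ZMod (2 ^ v)) ≠ 0 := fun h =>
  four_ne_zero_zmod hv (by linear_combination 2 * h)

theorem exists_odd_of_forall_ne {j : ZMod (2 ^ v)} (hj : ∀ y, 2 * y ≠ j) : ∃ y, j = 2 * y + 1 := by
  obtain ⟨y, h | h⟩ := even_or_odd_zmod j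
  · exact absurd h.symm (hj y)
  · exact ⟨y, h⟩

theorem two_mul_ne_odd (hv : 0 < v) (y w : ZMod (2 ^ v)) : 2 * y ≠ 2 * w + 1 := by
  intro h
  have := nontrivial_zmod hv
  exact (isNilpotent_two_mul y).not_isUnit (h ▸ isUnit_two_mul_add_one w)

/-- A map of `ZMod n` that turns a translation into the successor map is affine. -/
theorem affine_of_shift {n : ℕ} [NeZero n] {f : ZMod n → ZMod n} {k : ZMod n}
    (hf : ∀ x, f (x + k) = f x + 1) : ∃ u, u * k = 1 ∧ ∀ x, f x = u * x + f 0 := by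
  have hmul : ∀ m, f (m * k) = f 0 + m := by
    refine zmod_induction (by simp) fun m hm => ?_
    rw [add_mul, one_mul, hf, hm, add_assoc]
  have hsurj : Function.Surjective f := fun y => ⟨(y - f 0) * k, by rw [hmul]; ring⟩
  have hinj : Function.Injective f := Finite.injective_iff_surjective.2 hsurj
  have hu : (f 1 - f 0) * k = 1 := hinj (by rw [hmul]; ring)
  refine ⟨f 1 - f 0, hu, fun x => ?_⟩
  conv_lhs => rw [← mul_one x, ← hu, ← mul_assoc]
  rw [hmul]
  ring

/-- Fixed point free affine involutions of `ZMod (2 ^ v)`. -/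
theorem affine_involution (hv : 0 < v) {u c : ZMod (2 ^ v)}
    (hinv : ∀ x, u * (u * x + c) + c = x) (hfix : ∀ x, u * x + c ≠ x) :
    (u = 1 ∧ c = 2 ^ (v - 1)) ∨ (u = -1 ∧ ∀ y, 2 * y ≠ c) := by
  have := nontrivial_zmod hv
  have h0 : (u + 1) * c = 0 := by linear_combination hinv 0
  have h1 : u * u = 1 := by linear_combination hinv 1 - hinv 0
  have hc : c ≠ 0 := fun h => hfix 0 (by simp [h])
  obtain ⟨y, rfl | rfl⟩ := even_or_odd_zmod u
  · exact absurd (IsUnit.of_mul_eq_one _ h1) (isNilpotent_two_mul y).not_isUnit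
  -- Split on `u` modulo 4: for `u = 4w + 1` the factor `u + 1` is twice a unit, for `u = 4w + 3`
  -- the factor `u - 1` is.
  obtain ⟨w, rfl | rfl⟩ := even_or_odd_zmod y
  · left
    have hu := isUnit_two_mul_add_one w
    have hc2 : 2 * c = 0 := hu.mul_right_eq_zero.1 (by linear_combination h0)
    have hw2 : 2 * (2 * (2 * w)) = 0 := hu.mul_right_eq_zero.1 (by linear_combination h1)
    have hch := ((two_mul_eq_zero_zmod hv c).1 hc2).resolve_left hc
    refine ⟨?_, hch⟩
    rcases (two_mul_eq_zero_zmod hv _).1 hw2 with h | h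
    · rw [h, zero_add]
    · exact absurd (by rw [h, ← hch]; linear_combination hc2) (hfix 1)
  · right
    obtain ⟨r, hr⟩ := (isUnit_two_mul_add_one w).exists_left_inv
    have hodd : ∀ t, 2 * t ≠ c := by
      intro t ht
      apply hfix (-(r * t))
      linear_combination -2 * t * hr - ht
    refine ⟨?_, hodd⟩
    obtain ⟨t, ht⟩ := exists_odd_of_forall_ne hodd
    have hcu : IsUnit c := ht ▸ isUnit_two_mul_add_one t
    have := hcu.mul_left_eq_zero.1 h0
    linear_combination this

end ZMod

/-! ### Invariant pairings in the presence of a reflection. -/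

section Pairing

variable {v : ℕ} {s : ZMod (2 ^ v) → Perm (ZMod (2 ^ v))}

/-- A map commuting with all `s x` turns some translation into the successor map. -/
theorem IsCycloid.apply_commuting (hs : IsCycloid s) (hd : ∀ i, s i i = i + 1)
    {κ : ZMod (2 ^ v) → ZMod (2 ^ v)} (hκ : ∀ x y, s x (κ y) = κ (s x y)) :
    ∃ k, ∀ x, κ (x + k) = κ x + 1 := by
  -- The cycloid equation at `x`, `κ x`, applied to `x`.
  have hshift : ∀ x, s (κ (x + 1)) (x + 1) = s (κ x) x + 1 := by
    intro x
    have h := DFunLike.congr_fun (hs x (κ x)) x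
    simp only [Perm.mul_apply, hd, hκ] at h
    exact h
  have hk : ∀ x, s (κ x) x = x + s (κ 0) 0 := by
    refine zmod_induction (by simp) fun x hx => ?_
    rw [hshift, hx]
    ring
  refine ⟨s (κ 0) 0, fun x => ?_⟩
  rw [← hk, ← hκ, hd]

/-- A relation that pairs every point `x` with two points `y` and `j - y`,
invariantly under the permutations `s x`. -/
structure IsPairing (s : ZMod (2 ^ v) → Perm (ZMod (2 ^ v))) (j : ZMod (2 ^ v))
    (P : ZMod (2 ^ v) → ZMod (2 ^ v) → Prop) : Prop where
  map : ∀ z x y, P x y → P (s z x) (s z y)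
  symm : ∀ x y, P x y → P y x
  reflect : ∀ x y, P x y → P x (j - y)
  unique : ∀ x y y', P x y → P x y' → y' = y ∨ y' = j - y
  ne : ∀ x y, P x y → y ≠ x
  ne_reflect : ∀ x y, P x y → y ≠ j - x

variable {j : ZMod (2 ^ v)} {P : ZMod (2 ^ v) → ZMod (2 ^ v) → Prop}

/-- The shift makes `β` affine, and symmetry of `P` with `j` odd makes it an involution. If it is a
reflection `c - x`, then `j - β x` is a translation pairing the same points, and its step is the
element of order two. -/
theorem IsPairing.half_of_shift (hP : IsPairing s j P) (hv : 2 < v) (hj : ∀ y, 2 * y ≠ j)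
    (hκ : ∀ x y, s x (j - y) = j - s x y)
    {β : ZMod (2 ^ v) → ZMod (2 ^ v)} (hβ : ∀ x, β (x + 1) = s x (β x)) (hPβ : ∀ x, P x (β x))
    {k : ZMod (2 ^ v)} (hk : ∀ x, β x + 1 = β (x + k)) :
    ∀ x, P x (x + 2 ^ (v - 1)) ∧ s x (x + 2 ^ (v - 1)) = x + 1 + 2 ^ (v - 1) := by
  have hv0 : 0 < v := by omega
  obtain ⟨u, huk, haff⟩ := affine_of_shift fun x => (hk x).symm
  set c := β 0 with hc
  have hββ : ∀ x, β (β x) = x ∨ β (β x) = j - x := fun x =>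
    hP.unique _ _ _ (hP.symm _ _ (hPβ x)) (hPβ (β x))
  have hodd : ∀ y, u ≠ 2 * y := fun y hy =>
    have := nontrivial_zmod hv0
    (isNilpotent_two_mul y).not_isUnit (hy ▸ IsUnit.of_mul_eq_one _ huk)
  obtain ⟨w, hw⟩ := exists_odd_of_forall_ne fun y h => hodd y h.symm
  have h0 : u * c + c = 0 := by
    have := hββ 0
    rw [← hc, haff c] at this
    refine this.resolve_right fun h => hj ((w + 1) * c) ?_
    rw [hw] at h
    linear_combination h
  have h1 : u * u = 1 := by
    have := hββ 1
    rw [haff (β 1), haff 1] at this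
    rcases this with h | h
    · linear_combination h - h0
    · exfalso
      obtain ⟨t, ht⟩ := exists_odd_of_forall_ne hj
      refine two_mul_ne_odd hv0 t (2 * w * w + 2 * w) ?_
      rw [hw] at h h0
      linear_combination h0 - h - ht
  have hinv : ∀ x, u * (u * x + c) + c = x := fun x => by linear_combination x * h1 + h0
  rcases affine_involution hv0 hinv fun x h => hP.ne _ _ (hPβ x) (by rw [haff, h]) with
    ⟨rfl, hch⟩ | ⟨rfl, hcodd⟩
  · have hβx : ∀ x, β x = x + 2 ^ (v - 1) := fun x => by rw [haff, one_mul, hch]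
    intro x
    refine ⟨hβx x ▸ hPβ x, ?_⟩
    rw [← hβx, ← hβ, hβx]
  · have ht : ∀ x, P x (x + (j - c)) := fun x => by
      have := hP.reflect _ _ (hPβ x)
      rw [haff] at this
      convert this using 1
      ring
    have ht0 : j - c ≠ 0 := fun h => hP.ne _ _ (ht 0) (by rw [h, add_zero])
    have htt : 2 * (j - c) = 0 := by
      have := hP.unique _ _ _ (hP.symm _ _ (ht 0)) (ht (0 + (j - c)))
      rcases this with h | h
      · linear_combination h
      · exact absurd (by linear_combination h) (hj (j - c))
    have hth := ((two_mul_eq_zero_zmod hv0 _).1 htt).resolve_left ht0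
    intro x
    rw [← hth]
    refine ⟨ht x, ?_⟩
    have h2 : x + (j - c) = j - β x := by rw [haff]; ring
    rw [h2, hκ, ← hβ, haff]
    ring

/-- The cycloid equation shows that `β x + 1` is `β (x + k)` up to reflection, uniformly in `x`, and
likewise for the other section `j - β`. If neither is a pure shift, composing the two reflected
shifts translates `β` by 2, and doing so twice gives `4 = 0`. -/
theorem IsPairing.half_of_section (hs : IsCycloid s) (hd : ∀ i, s i i = i + 1)
    (hP : IsPairing s j P) (hv : 2 < v) (hj : ∀ y, 2 * y ≠ j)
    (hκ : ∀ x y, s x (j - y) = j - s x y)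
    {β : ZMod (2 ^ v) → ZMod (2 ^ v)} (hβ : ∀ x, β (x + 1) = s x (β x)) (hPβ : ∀ x, P x (β x)) :
    ∀ x, P x (x + 2 ^ (v - 1)) ∧ s x (x + 2 ^ (v - 1)) = x + 1 + 2 ^ (v - 1) := by
  have key : ∀ γ : ZMod (2 ^ v) → ZMod (2 ^ v), (∀ x, γ (x + 1) = s x (γ x)) →
      (∀ x, P x (γ x)) → ∃ k, (∀ x, γ x + 1 = γ (x + k)) ∨ (∀ x, γ x + 1 = j - γ (x + k)) := by
    intro γ hγ hPγ
    have hk : ∀ x, s (γ x) x = x + s (γ 0) 0 := by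
      refine zmod_induction (by simp) fun x hx => ?_
      have h := DFunLike.congr_fun (hs x (γ x)) x
      simp only [Perm.mul_apply, hd, ← hγ, hx] at h
      rw [h]
      ring
    set k := s (γ 0) 0 with hkdef
    have hstep : ∀ x, γ (x + 1) + 1 = s (x + k) (γ x + 1) := by
      intro x
      have h := DFunLike.congr_fun (hs x (γ x)) (γ x)
      simp only [Perm.mul_apply, hd, ← hγ, hk] at h
      exact h
    -- Applying `s (γ 0)` to the pair `0, γ 0` shows that `γ 0 + 1` is paired with `k`; `hstep` then
    -- propagates the alternative found at `0`.
    have h0 := hP.unique _ _ _ (hPγ (0 + k)) (by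
      have := hP.map (γ 0) _ _ (hPγ 0)
      rwa [hd, hk] at this)
    refine ⟨k, h0.imp (fun h => ?_) fun h => ?_⟩
    · refine zmod_induction h fun x hx => ?_
      rw [hstep, hx, ← hγ]
      congr 1
      ring
    · refine zmod_induction h fun x hx => ?_
      rw [hstep, hx, hκ, ← hγ]
      congr 2
      ring
  have hβ' : ∀ x, j - β (x + 1) = s x (j - β x) := fun x => by rw [hκ, hβ]
  obtain ⟨k, hk | hk⟩ := key β hβ hPβ
  · exact hP.half_of_shift hv hj hκ hβ hPβ hk
  obtain ⟨l, hl | hl⟩ := key (fun x => j - β x) hβ' fun x => hP.reflect _ _ (hPβ x)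
  · exact hP.half_of_shift hv hj hκ hβ' (fun x => hP.reflect _ _ (hPβ x)) hl
  exfalso
  have hk' : ∀ x, β (x + k) = j - 1 - β x := fun x => by linear_combination hk x
  have hl' : ∀ x, β (x + l) = j + 1 - β x := fun x => by linear_combination - hl x
  have hfib : ∀ x y, β x = β y → y = x ∨ y = j - x := by
    intro x y h
    exact hP.unique _ _ _ (hP.symm _ _ (hPβ x)) (h ▸ hP.symm _ _ (hPβ y))
  have hk2 : 2 * k = 0 := by
    rcases hfib 0 (0 + k + k) (by rw [hk', hk']; ring) with h | h
    · linear_combination h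
    · exact absurd (by linear_combination h) (hj k)
  have hl2 : 2 * l = 0 := by
    rcases hfib 0 (0 + l + l) (by rw [hl', hl']; ring) with h | h
    · linear_combination h
    · exact absurd (by linear_combination h) (hj l)
  have h4 : β (0 + k + l + k + l) = β 0 + 4 := by
    rw [hl', hk', hl', hk']
    ring
  rw [show (0 + k + l + k + l : ZMod (2 ^ v)) = 0 by linear_combination hk2 + hl2] at h4
  exact four_ne_zero_zmod hv (by linear_combination -h4)

/-- A pairing is given by the translation of order two. -/
theorem IsPairing.half (hs : IsCycloid s) (hd : ∀ i, s i i = i + 1)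
    (hP : IsPairing s j P) (hv : 2 < v) (hj : ∀ y, 2 * y ≠ j)
    (hκ : ∀ x y, s x (j - y) = j - s x y) {b : ZMod (2 ^ v)} (hb : P 0 b) :
    ∀ x, P x (x + 2 ^ (v - 1)) ∧ s x (x + 2 ^ (v - 1)) = x + 1 + 2 ^ (v - 1) := by
  -- Indexed by `ℕ`, since one turn around the cycle may return the reflected value.
  let β : ℕ → ZMod (2 ^ v) := fun i => Nat.rec b (fun i y => s (i : ZMod (2 ^ v)) y) i
  have hβ0 : β 0 = b := rfl
  have hβ : ∀ i : ℕ, β (i + 1) = s (i : ZMod (2 ^ v)) (β i) := fun _ => rfl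
  have hPβ : ∀ i : ℕ, P (i : ZMod (2 ^ v)) (β i) := by
    intro i
    induction i with
    | zero => rw [Nat.cast_zero]; exact hb
    | succ i ih =>
      have := hP.map i _ _ ih
      rw [hd] at this
      rw [hβ]
      exact_mod_cast this
  have hn : ((2 ^ v : ℕ) : ZMod (2 ^ v)) = 0 := ZMod.natCast_self _
  rcases hP.unique _ _ _ (hPβ 0) (by have := hPβ (2 ^ v); rwa [hn, ← Nat.cast_zero] at this)
    with hper | hper
  · have hper' : Function.Periodic β (2 ^ v) := by
      intro i
      induction i with
      | zero => simpa using hper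
      | succ i ih =>
        rw [add_right_comm, hβ, ih, hβ, Nat.cast_add, hn, add_zero]
    have hval : ∀ i : ℕ, β ((i : ZMod (2 ^ v)).val) = β i := fun i => by
      rw [ZMod.val_natCast, hper'.map_mod_nat]
    refine hP.half_of_section hs hd hv hj hκ (β := fun x => β x.val) (fun x => ?_) fun x => ?_
    · rw [← ZMod.natCast_zmod_val x, ← Nat.cast_succ, hval, hval, hβ]
    · have := hPβ x.val
      rwa [ZMod.natCast_zmod_val] at this
  · exfalso
    have hanti : ∀ i, β (i + 2 ^ v) = j - β i := by
      intro i
      induction i with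
      | zero => simpa using hper
      | succ i ih =>
        rw [add_right_comm, hβ, ih, hβ, Nat.cast_add, hn, add_zero, hκ]
    have hk : ∀ i : ℕ, s (β i) i = i + s (β 0) 0 := by
      intro i
      induction i with
      | zero => simp
      | succ i ih =>
        have h := DFunLike.congr_fun (hs i (β i)) (i : ZMod (2 ^ v))
        simp only [Perm.mul_apply, hd, ← hβ, ih] at h
        rw [Nat.cast_succ, h]
        ring
    set k := s (β 0) 0 with hkdef
    have hstep : ∀ i : ℕ, β (i + 1) + 1 = s (i + k) (β i + 1) := by
      intro i
      have h := DFunLike.congr_fun (hs i (β i)) (β i)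
      simp only [Perm.mul_apply, hd, ← hβ, hk] at h
      exact h
    obtain ⟨m, hmk, hm⟩ : ∃ m : ℕ, (m : ZMod (2 ^ v)) = k ∧ β 0 + 1 = β m := by
      have h0 := hP.unique _ _ _ (hPβ k.val) (by
        have := hP.map (β 0) _ _ (hPβ 0)
        rw [hd, hk, Nat.cast_zero, zero_add] at this
        rwa [ZMod.natCast_zmod_val])
      rcases h0 with h | h
      · exact ⟨k.val, ZMod.natCast_zmod_val k, h⟩
      · exact ⟨k.val + 2 ^ v, by rw [Nat.cast_add, hn, add_zero, ZMod.natCast_zmod_val],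
          h.trans (hanti _).symm⟩
    have hall : ∀ i : ℕ, β i + 1 = β (i + m) := by
      intro i
      induction i with
      | zero => rw [zero_add, hm]
      | succ i ih =>
        rw [hstep, ih, add_right_comm, hβ, Nat.cast_add, hmk]
    -- After one turn the reflection changes the sign of the step in `β i + 1 = β (i + m)`, forcing
    -- `1 = -1`.
    have h := hall (0 + 2 ^ v)
    rw [add_right_comm, hanti, hanti, ← hall 0] at h
    exact two_ne_zero_zmod hv (by linear_combination h)

end Pairing

theorem exists_central_involution {G : Type*} [Group G] [Finite G] [Nontrivial G]
    (hG : IsPGroup 2 G) : ∃ c : G, c ≠ 1 ∧ c * c = 1 ∧ ∀ g, g * c = c * g := by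
  have := hG.center_nontrivial
  obtain ⟨k, hk⟩ := IsPGroup.iff_card.1 (hG.to_subgroup (Subgroup.center G))
  have hdvd : 2 ∣ Nat.card (Subgroup.center G) := by
    rw [hk]
    refine dvd_pow_self 2 ?_
    rintro rfl
    exact (Finite.one_lt_card (α := Subgroup.center G)).ne' (by simpa using hk)
  obtain ⟨c, hc⟩ := exists_prime_orderOf_dvd_card' 2 hdvd
  obtain ⟨hc2, hc1⟩ := orderOf_eq_prime_iff.1 hc
  refine ⟨c, fun h => hc1 (Subtype.ext h), ?_, fun g => Subgroup.mem_center_iff.1 c.2 g⟩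
  rw [← pow_two]
  exact congrArg Subtype.val hc2

/-! ### The fixed brace element and commutation with the half translation. -/

section

variable {v : ℕ} {s : ZMod (2 ^ v) → Perm (ZMod (2 ^ v))}

theorem IsCycloid.toPerm_add_apply {X : Type*} [Finite X] {s : X → Perm X} (hs : IsCycloid s)
    (a b : hs.Brace) (x : X) :
    (hs.toPerm (a + b) : Perm X) x =
      (hs.toPerm (hs.toPerm a • b) : Perm X) ((hs.toPerm a : Perm X) x) := by
  rw [hs.toPerm_add]
  rfl

/-- Expand `z + b = b + z` in both orders; on one side the twist of `z` disappears. -/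
theorem IsCycloid.toPerm_fixed_smul {X : Type*} [Finite X] {s : X → Perm X} (hs : IsCycloid s)
    {z : hs.Brace} (hz : ∀ g : hs.permGroup, g • z = z) (b : hs.Brace) (x : X) :
    (hs.toPerm (hs.toPerm z • b) : Perm X) ((hs.toPerm z : Perm X) x) =
      (hs.toPerm z : Perm X) ((hs.toPerm b : Perm X) x) := by
  rw [← hs.toPerm_add_apply, add_comm, hs.toPerm_add_apply, hz]

/-- A fixed element of order two in the brace acts by the translation of order two. -/
theorem IsCycloid.toPerm_fixed (hs : IsCycloid s) (hd : ∀ i, s i i = i + 1) (hv : 0 < v)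
    {z : hs.Brace} (hz : ∀ g : hs.permGroup, g • z = z) (hz0 : z ≠ 0) (hz2 : z + z = 0)
    (x : ZMod (2 ^ v)) : (hs.toPerm z : Perm (ZMod (2 ^ v))) x = x + 2 ^ (v - 1) := by
  -- Invariance of `z` makes its permutation commute with the diagonal.
  have hstep : ∀ x, (hs.toPerm z : Perm (ZMod (2 ^ v))) (x + 1) = (hs.toPerm z : Perm (ZMod (2 ^ v))) x + 1 := by
    intro x
    have := hs.diag_smul z x
    rwa [hz, hd, hd, eq_comm] at this
  have hall : ∀ x, (hs.toPerm z : Perm (ZMod (2 ^ v))) x = x + (hs.toPerm z : Perm (ZMod (2 ^ v))) 0 := by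
    refine zmod_induction (by simp) fun x hx => ?_
    rw [hstep, hx]
    ring
  have h2 : 2 * (hs.toPerm z : Perm (ZMod (2 ^ v))) 0 = 0 := by
    have := hs.toPerm_add_apply z z 0
    rw [hz2, hs.toPerm_zero, hz, hall ((hs.toPerm z : Perm (ZMod (2 ^ v))) 0), ← two_mul] at this
    exact this.symm
  have h0 : (hs.toPerm z : Perm (ZMod (2 ^ v))) 0 ≠ 0 := by
    intro h
    refine hz0 (hs.toPerm_bijective.1 (Subtype.ext (Equiv.ext fun x => ?_)))
    rw [hall, h, add_zero, hs.toPerm_zero]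
    rfl
  rw [hall, ((two_mul_eq_zero_zmod hv _).1 h2).resolve_left h0]

/-- If commutation fails at `y`, `x`, it also fails at `y`, `x + h`. The two failures compute `s (j
- y) x`, up to reflection, as `w - 2` and as `w + 2`, where `w = s y x`; since `4 ≠ 0` and `j` is
odd, this is impossible. -/
theorem IsCycloid.half_commutes_of_reflection (hs : IsCycloid s) (hd : ∀ i, s i i = i + 1)
    (hv : 2 < v) {j : ZMod (2 ^ v)} (hj : ∀ y, 2 * y ≠ j)
    {z : hs.Brace} (hz : ∀ g : hs.permGroup, g • z = z)
    (hzh : ∀ x, (hs.toPerm z : Perm (ZMod (2 ^ v))) x = x + 2 ^ (v - 1))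
    (hκ : ∀ (g : hs.permGroup) y, (g : Perm (ZMod (2 ^ v))) (j - y) = j - (g : Perm (ZMod (2 ^ v))) y)
    (hτ : ∀ (g : hs.permGroup) y, (g : Perm (ZMod (2 ^ v))) (y + 2 ^ (v - 1)) = (g : Perm (ZMod (2 ^ v))) y + 2 ^ (v - 1) ∨
      (g : Perm (ZMod (2 ^ v))) (y + 2 ^ (v - 1)) = j - ((g : Perm (ZMod (2 ^ v))) y + 2 ^ (v - 1)))
    (hsτ : ∀ x, s x (x + 2 ^ (v - 1)) = x + 1 + 2 ^ (v - 1)) (y x : ZMod (2 ^ v)) :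
    s y (x + 2 ^ (v - 1)) = s y x + 2 ^ (v - 1) := by
  set h : ZMod (2 ^ v) := 2 ^ (v - 1) with hh
  have hh2 : 2 * h = 0 := (two_mul_eq_zero_zmod (by omega) h).2 (Or.inr rfl)
  have hg : ∀ x, (hs.toPerm (hs.gen x) : Perm (ZMod (2 ^ v))) = s x := hs.coe_toPerm_gen
  have hsκ : ∀ x y, s x (j - y) = j - s x y := fun x y => by rw [← hg, hκ]
  have hconj : ∀ b y, (hs.toPerm (hs.toPerm z • b) : Perm (ZMod (2 ^ v))) (y + h) =
      (hs.toPerm b : Perm (ZMod (2 ^ v))) y + h := fun b y => by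
    rw [← hzh, hs.toPerm_fixed_smul hz, hzh]
  have hs1 : ∀ x y, s (x + h) (y + h) = s x y + h := fun x y => by
    have := hconj (hs.gen x) y
    rwa [hs.smul_gen, hzh, hg, hg] at this
  -- Differences of generators along the translation (`δ`) and the reflection (`D`). `δ x` preserves
  -- every pair `{y, j - y}` and fixes `x`, whereas `D x` moves `x` by `-2` and `j - x` by `+2`.
  let δ : ZMod (2 ^ v) → hs.Brace := fun x => hs.gen (x + h) - hs.gen x
  let D : ZMod (2 ^ v) → hs.Brace := fun x => hs.gen (j - x) - hs.gen x
  have hδdef : ∀ x, δ x = hs.gen (x + h) - hs.gen x := fun _ => rfl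
  have hDdef : ∀ x, D x = hs.gen (j - x) - hs.gen x := fun _ => rfl
  have hδ1 : ∀ x y, (hs.toPerm (δ (x + 1)) : Perm (ZMod (2 ^ v))) (s x y) = s x (y + h) + h := by
    intro x y
    have h1 : hs.toPerm (hs.gen x) • δ x = δ (x + 1) := by
      rw [hδdef, hδdef, smul_sub, hs.smul_gen, hs.smul_gen, hg, hd, hsτ]
    have h2 := hs.toPerm_add_apply (hs.gen x) (δ x) y
    rw [h1, hδdef x, add_sub_cancel, hg, hg] at h2
    rw [← h2, ← hs1, add_assoc, ← two_mul, hh2, add_zero]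
  have hδK : ∀ x y, (hs.toPerm (δ x) : Perm (ZMod (2 ^ v))) y = y ∨ (hs.toPerm (δ x) : Perm (ZMod (2 ^ v))) y = j - y := by
    intro x y
    obtain ⟨x, rfl⟩ : ∃ x', x = x' + 1 := ⟨x - 1, by ring⟩
    obtain ⟨y, rfl⟩ := (s x).surjective y
    rw [hδ1]
    have := hτ (hs.toPerm (hs.gen x)) y
    rw [hg] at this
    rcases this with h' | h'
    · left; rw [h']; linear_combination hh2
    · right; rw [h']; ring
  have hδfix : ∀ x, (hs.toPerm (δ x) : Perm (ZMod (2 ^ v))) x = x := by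
    intro x
    obtain ⟨x, rfl⟩ : ∃ x', x = x' + 1 := ⟨x - 1, by ring⟩
    have := hδ1 x x
    rw [hd, hsτ] at this
    rw [this]
    linear_combination hh2
  have hDfix : ∀ x, (hs.toPerm (D x) : Perm (ZMod (2 ^ v))) x = x - 2 := by
    intro x
    obtain ⟨x, rfl⟩ : ∃ x', x = x' + 1 := ⟨x - 1, by ring⟩
    have h1 : hs.toPerm (hs.gen x) • D x = D (x + 1) := by
      rw [hDdef, hDdef, smul_sub, hs.smul_gen, hs.smul_gen, hg, hd, hsκ, hd]
    have h2 := hs.toPerm_add_apply (hs.gen x) (D x) x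
    rw [h1, hDdef x, add_sub_cancel, hg, hg, hd] at h2
    have h3 := hsκ (j - x) (j - x)
    rw [hd, sub_sub_cancel] at h3
    rw [← h2, h3]
    ring
  have hDfix' : ∀ x, (hs.toPerm (D (j - x)) : Perm (ZMod (2 ^ v))) x = x + 2 := by
    intro x
    have := hκ (hs.toPerm (D (j - x))) (j - x)
    rw [sub_sub_cancel, hDfix] at this
    rw [this]
    ring
  have key : ∀ x, s y (x + h) = j - (s y x + h) → ∀ u,
      s (j - y) u = (hs.toPerm (D (s y x)) : Perm (ZMod (2 ^ v))) (s y u) ∨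
      s (j - y) u = j - (hs.toPerm (D (s y x)) : Perm (ZMod (2 ^ v))) (s y u) := by
    intro x hx
    set w := s y x with hw
    have hfix : (hs.toPerm (δ (j - w)) : Perm (ZMod (2 ^ v))) w = w := by
      have := hκ (hs.toPerm (δ (j - w))) (j - w)
      rwa [sub_sub_cancel, hδfix, sub_sub_cancel] at this
    have h1 : hs.toPerm (hs.gen y) • δ x = δ (j - w) + D w := by
      rw [hδdef, hδdef, hDdef, smul_sub, hs.smul_gen, hs.smul_gen, hg, hx, sub_add_sub_cancel]
      congr 2
      linear_combination -hh2
    have h2 : hs.toPerm (δ (j - w)) • D w = D w := by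
      rw [hDdef, smul_sub, hs.smul_gen, hs.smul_gen, hκ, hfix]
    -- Expand `δ x + gen y` in both orders; the failure at `x` turns the twisted `δ x` into `δ (j -
    -- w) + D w`.
    have h3 : ∀ u, s ((hs.toPerm (δ x) : Perm (ZMod (2 ^ v))) y) ((hs.toPerm (δ x) : Perm (ZMod (2 ^ v))) u) =
        (hs.toPerm (D w) : Perm (ZMod (2 ^ v))) ((hs.toPerm (δ (j - w)) : Perm (ZMod (2 ^ v))) (s y u)) := by
      intro u
      have := hs.toPerm_add_apply (δ x) (hs.gen y) u
      rw [hs.smul_gen, hg, add_comm, hs.toPerm_add_apply, h1, hs.toPerm_add_apply, h2, hg] at this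
      exact this.symm
    have h4 : ∀ u, s ((hs.toPerm (δ x) : Perm (ZMod (2 ^ v))) y) u = (hs.toPerm (D w) : Perm (ZMod (2 ^ v))) (s y u) ∨
        s ((hs.toPerm (δ x) : Perm (ZMod (2 ^ v))) y) u = j - (hs.toPerm (D w) : Perm (ZMod (2 ^ v))) (s y u) := by
      intro u
      have h := h3 u
      rcases hδK x u with hu | hu <;> rcases hδK (j - w) (s y u) with hu' | hu' <;>
        rw [hu, hu'] at h
      · exact Or.inl h
      · right; rw [h, hκ]
      · right; rw [← h, hsκ, sub_sub_cancel]
      · left; rwa [hsκ, hκ, sub_right_inj] at h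
    have h5 : (hs.toPerm (δ x) : Perm (ZMod (2 ^ v))) y = j - y := by
      refine (hδK x y).resolve_left fun hy => ?_
      rcases h4 x with h | h <;> rw [hy, ← hw, hDfix] at h
      · exact two_ne_zero_zmod hv (by linear_combination h)
      · exact hj (w - 1) (by linear_combination h)
    rwa [h5] at h4
  have hor := hτ (hs.toPerm (hs.gen y)) x
  rw [hg] at hor
  refine hor.resolve_right fun hx => ?_
  set w := s y x with hw
  have hx2 : s y (x + h + h) = j - (s y (x + h) + h) := by
    rw [hx, add_assoc, ← two_mul, hh2, add_zero, ← hw]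
    ring
  have e1 := key x hx x
  have e2 := key (x + h) hx2 x
  rw [← hw, hDfix] at e1
  have hDz : D (j - (w + h)) = hs.toPerm z • D (j - w) := by
    rw [hDdef, hDdef, smul_sub, hs.smul_gen, hs.smul_gen, hzh, hzh]
    congr 2
    · ring
    · linear_combination -hh2
  have e3 := hτ (hs.toPerm (D (j - w))) w
  rw [hDfix'] at e3
  have e4 := hconj (D (j - w)) (w + h)
  rw [add_assoc, ← two_mul, hh2, add_zero] at e4
  rw [hx, hDz, ← hw, e4] at e2
  have a1 : ∀ {P : Prop}, w - 2 = w + 2 → P := fun h =>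
    absurd (by linear_combination -h) (four_ne_zero_zmod hv)
  have a2 : ∀ {P : Prop}, w - 2 = j - (w + 2) → P := fun h =>
    absurd (by linear_combination h) (hj w)
  rcases e1 with e1 | e1 <;> rcases e2 with e2 | e2 <;> rcases e3 with e3 | e3 <;>
    rw [e1, e3] at e2
  · exact a1 (by linear_combination e2 + hh2)
  · exact a2 (by linear_combination e2)
  · exact a2 (by linear_combination e2 - hh2)
  · exact a1 (by linear_combination e2)
  · exact a2 (by linear_combination -e2 - hh2)
  · exact a1 (by linear_combination -e2)
  · exact a1 (by linear_combination -e2 + hh2)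
  · exact a2 (by linear_combination -e2)

end

/-! ### The pairing from a quotient of the permutation group, and the conclusion on `ZMod (2 ^ v)`.
-/

section

variable {v : ℕ} {s : ZMod (2 ^ v) → Perm (ZMod (2 ^ v))}

theorem addRight_one_isCycleOn {n : ℕ} [NeZero n] :
    (Equiv.addRight (1 : ZMod n)).IsCycleOn Set.univ := by
  refine ⟨(Equiv.addRight (1 : ZMod n)).bijective.bijOn_univ, fun x _ y _ => ?_⟩
  revert y
  have h : ∀ z, (Equiv.addRight (1 : ZMod n)).SameCycle x (x + z) := by
    refine zmod_induction (by rw [add_zero]) fun z hz => ?_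
    rw [← add_assoc]
    exact hz.trans ⟨1, rfl⟩
  intro y
  simpa using h (y - x)

/-- The elements of the permutation group preserving all pairs `{x, κ x}`
of a central involution `κ`. -/
def pairKernel {X : Type*} (G : Subgroup (Perm X)) (κ : Perm X) (hκ2 : ∀ x, κ (κ x) = x)
    (hκ : ∀ g ∈ G, ∀ x, g (κ x) = κ (g x)) : Subgroup G where
  carrier := {g | ∀ x, (g : Perm X) x = x ∨ (g : Perm X) x = κ x}
  mul_mem' := by
    intro g k hg hk x
    change (g : Perm X) ((k : Perm X) x) = x ∨ (g : Perm X) ((k : Perm X) x) = κ x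
    rcases hk x with h | h <;> rw [h]
    · exact hg x
    · rw [hκ g g.2]
      rcases hg x with h' | h' <;> rw [h']
      · exact Or.inr rfl
      · exact Or.inl (hκ2 x)
  one_mem' := fun _ => Or.inl rfl
  inv_mem' := by
    intro g hg x
    have hx : ∀ y, (g : Perm X) y = x → ((g⁻¹ : G) : Perm X) x = y := by
      rintro y rfl
      simp
    rcases hg x with h | h
    · exact Or.inl (hx _ h)
    · exact Or.inr (hx _ (by rw [hκ g g.2, h, hκ2]))

theorem pairKernel_normal {X : Type*} (G : Subgroup (Perm X)) (κ : Perm X)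
    (hκ2 : ∀ x, κ (κ x) = x) (hκ : ∀ g ∈ G, ∀ x, g (κ x) = κ (g x)) :
    (pairKernel G κ hκ2 hκ).Normal := by
  refine ⟨fun k hk g x => ?_⟩
  change (g : Perm X) ((k : Perm X) (((g⁻¹ : G) : Perm X) x)) = x ∨
    (g : Perm X) ((k : Perm X) (((g⁻¹ : G) : Perm X) x)) = κ x
  have hx : (g : Perm X) (((g⁻¹ : G) : Perm X) x) = x := by simp
  rcases hk (((g⁻¹ : G) : Perm X) x) with h | h <;> rw [h]
  · exact Or.inl hx
  · rw [hκ g g.2, hx]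
    exact Or.inr rfl

/-- Lift a central involution of the group modulo `pairKernel` to `d` and pair `x` with `d x` and `j
- d x`: centrality and order two hold up to reflection, which is all a pairing needs. -/
theorem IsCycloid.exists_pairing (hs : IsCycloid s) (hd : ∀ i, s i i = i + 1) (hv : 2 < v)
    (h2 : IsPGroup 2 hs.permGroup) {j : ZMod (2 ^ v)}
    (hκ : ∀ g ∈ hs.permGroup, ∀ y, g (j - y) = j - g y) :
    ∃ P : ZMod (2 ^ v) → ZMod (2 ^ v) → Prop, IsPairing s j P ∧ (∃ b, P 0 b) ∧
      ∀ g ∈ hs.permGroup, ∀ x y, P x y → P (g x) (g y) := by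
  have hsmem : ∀ x, s x ∈ hs.permGroup := fun x =>
    hs.coe_toPerm_gen x ▸ (hs.toPerm (hs.gen x)).2
  let K := pairKernel hs.permGroup (Equiv.subLeft j) (fun x => sub_sub_cancel j x) hκ
  have hK : ∀ {g : hs.permGroup}, g ∈ K ↔ ∀ x, (g : Perm (ZMod (2 ^ v))) x = x ∨ (g : Perm (ZMod (2 ^ v))) x = j - x :=
    Iff.rfl
  have : K.Normal := pairKernel_normal _ _ _ _
  have hnon : Nontrivial (hs.permGroup ⧸ K) := by
    rw [← not_subsingleton_iff_nontrivial]
    intro hsub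
    have hall : ∀ x, (⟨s x, hsmem x⟩ : hs.permGroup) ∈ K := fun x =>
      (QuotientGroup.eq_one_iff _).1 (Subsingleton.elim _ _)
    have := nontrivial_zmod (show 0 < v by omega)
    have h0 := hK.1 (hall 0) 0
    have h1 := hK.1 (hall 1) 1
    simp only [hd, add_eq_left, one_ne_zero, false_or] at h0 h1
    exact two_ne_zero_zmod hv (by linear_combination h1 - h0)
  obtain ⟨d', hd1, hd2, hdc⟩ := exists_central_involution (h2.to_quotient K)
  obtain ⟨d, rfl⟩ := QuotientGroup.mk_surjective d'
  have hdK : d ∉ K := fun h => hd1 ((QuotientGroup.eq_one_iff d).2 h)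
  have hdd : ∀ x, (d : Perm (ZMod (2 ^ v))) ((d : Perm (ZMod (2 ^ v))) x) = x ∨ (d : Perm (ZMod (2 ^ v))) ((d : Perm (ZMod (2 ^ v))) x) = j - x :=
    hK.1 ((QuotientGroup.eq_one_iff (d * d)).1 hd2)
  have hcomm : ∀ g ∈ hs.permGroup, ∀ x, g ((d : Perm (ZMod (2 ^ v))) x) = (d : Perm (ZMod (2 ^ v))) (g x) ∨
      g ((d : Perm (ZMod (2 ^ v))) x) = j - (d : Perm (ZMod (2 ^ v))) (g x) := by
    intro g hg x
    have h := hK.1 (QuotientGroup.eq.1 (hdc (⟨g, hg⟩ : hs.permGroup)).symm) x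
    have e : (d : Perm (ZMod (2 ^ v))) (g ((((d * ⟨g, hg⟩)⁻¹ * (⟨g, hg⟩ * d) : hs.permGroup) :
        Perm (ZMod (2 ^ v))) x)) = g ((d : Perm (ZMod (2 ^ v))) x) := by
      simp [mul_assoc]
    rcases h with h | h <;> rw [h] at e
    · exact Or.inl e.symm
    · rw [hκ g hg, hκ d d.2] at e
      exact Or.inr e.symm
  have hdκ := hκ d d.2
  -- One preserved pair would spread along the diagonal to all pairs, putting `d` in the kernel.
  have hne : ∀ x, ¬ ((d : Perm (ZMod (2 ^ v))) x = x ∨ (d : Perm (ZMod (2 ^ v))) x = j - x) := by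
    intro x hx
    apply hdK
    rw [hK]
    have hall : ∀ y, (d : Perm (ZMod (2 ^ v))) (x + y) = x + y ∨ (d : Perm (ZMod (2 ^ v))) (x + y) = j - (x + y) := by
      refine zmod_induction (by rwa [add_zero]) fun y hy => ?_
      rw [← add_assoc, ← hd (x + y)]
      rcases hcomm _ (hsmem (x + y)) (x + y) with h | h <;> rcases hy with h' | h' <;>
        rw [h'] at h
      · exact Or.inl h.symm
      · rw [hκ _ (hsmem _)] at h
        exact Or.inr h.symm
      · right; linear_combination h
      · rw [hκ _ (hsmem _), sub_right_inj] at h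
        exact Or.inl h.symm
    intro y
    simpa using hall (y - x)
  have hmap : ∀ g ∈ hs.permGroup, ∀ x y,
      (y = (d : Perm (ZMod (2 ^ v))) x ∨ y = j - (d : Perm (ZMod (2 ^ v))) x) →
      (g y = (d : Perm (ZMod (2 ^ v))) (g x) ∨ g y = j - (d : Perm (ZMod (2 ^ v))) (g x)) := by
    intro g hg x y hy
    rcases hcomm g hg x with h | h <;> rcases hy with rfl | rfl
    · exact Or.inl h
    · right; rw [hκ g hg, h]
    · exact Or.inr h
    · left; rw [hκ g hg, h, sub_sub_cancel]
  refine ⟨fun x y => y = (d : Perm (ZMod (2 ^ v))) x ∨ y = j - (d : Perm (ZMod (2 ^ v))) x,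
    ⟨fun z => hmap _ (hsmem z), ?_, ?_, ?_, ?_, ?_⟩, ⟨_, Or.inl rfl⟩, hmap⟩
  · rintro x y (rfl | rfl)
    · rcases hdd x with h | h <;> rw [h]
      · exact Or.inl rfl
      · right; rw [sub_sub_cancel]
    · rw [hdκ]
      rcases hdd x with h | h <;> rw [h]
      · right; rw [sub_sub_cancel]
      · left; rw [sub_sub_cancel]
  · rintro x y (rfl | rfl)
    · exact Or.inr rfl
    · left; rw [sub_sub_cancel]
  · rintro x y y' (rfl | rfl) (rfl | rfl)
    · exact Or.inl rfl
    · exact Or.inr rfl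
    · right; rw [sub_sub_cancel]
    · exact Or.inl rfl
  · rintro x y (h | h) rfl
    · exact hne y (Or.inl h.symm)
    · exact hne y (Or.inr (by linear_combination h))
  · rintro x y (h | h) rfl
    · exact hne x (Or.inr h.symm)
    · exact hne x (Or.inl (sub_right_injective h).symm)

theorem IsCycloid.exists_eq_of_diag (hs : IsCycloid s) (hd : ∀ i, s i i = i + 1) (hv : 2 < v) :
    ∃ x y, x ≠ y ∧ s x = s y := by
  have hv0 : 0 < v := by omega
  have hnt := nontrivial_zmod hv0
  have hg : ∀ x, (hs.toPerm (hs.gen x) : Perm (ZMod (2 ^ v))) = s x := hs.coe_toPerm_gen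
  have h2 : IsPGroup 2 hs.permGroup :=
    hs.isPGroup_two (Nat.card_zmod _) _ addRight_one_isCycleOn fun x => (hd x).symm
  have hs1 : s 0 ≠ 1 := fun h => by simpa [h] using hd 0
  obtain ⟨z, hz0, hz2, hz⟩ := hs.exists_fixed h2 ⟨0, hs1⟩
  have hzh := hs.toPerm_fixed hd hv0 hz hz0 hz2
  suffices hcomm : ∀ y x, s y (x + 2 ^ (v - 1)) = s y x + 2 ^ (v - 1) by
    refine ⟨0 + 2 ^ (v - 1), 0, by simpa using half_ne_zero hv0, Equiv.ext fun x => ?_⟩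
    have h := hs.toPerm_fixed_smul hz (hs.gen 0) x
    rw [hs.smul_gen, hg, hg, hzh, hzh, hzh, hcomm] at h
    exact add_right_cancel h
  have : Nontrivial hs.permGroup :=
    ⟨⟨hs.toPerm (hs.gen 0), 1, fun h => hs1 (by rw [← hg, h]; rfl)⟩⟩
  obtain ⟨κ, hκ1, hκ2, hκc⟩ := exists_central_involution h2
  have hκ : ∀ (g : hs.permGroup) x,
      (g : Perm (ZMod (2 ^ v))) ((κ : Perm (ZMod (2 ^ v))) x) = (κ : Perm (ZMod (2 ^ v))) ((g : Perm (ZMod (2 ^ v))) x) := fun g x =>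
    congrArg (fun k : hs.permGroup => (k : Perm (ZMod (2 ^ v))) x) (hκc g)
  have hsκ : ∀ x y, s x ((κ : Perm (ZMod (2 ^ v))) y) = (κ : Perm (ZMod (2 ^ v))) (s x y) := fun x y => by
    rw [← hg, hκ]
  obtain ⟨k, hk⟩ := hs.apply_commuting hd hsκ
  obtain ⟨u, -, haff⟩ := affine_of_shift hk
  have hinv : ∀ x, (κ : Perm (ZMod (2 ^ v))) ((κ : Perm (ZMod (2 ^ v))) x) = x := fun x =>
    congrArg (fun k : hs.permGroup => (k : Perm (ZMod (2 ^ v))) x) hκ2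
  have hfix : ∀ x, (κ : Perm (ZMod (2 ^ v))) x ≠ x := by
    intro x hx
    refine hκ1 (Subtype.ext (Equiv.ext fun y => ?_))
    have hall : ∀ y, (κ : Perm (ZMod (2 ^ v))) (x + y) = x + y := by
      refine zmod_induction (by rwa [add_zero]) fun y hy => ?_
      rw [← add_assoc, ← hd, ← hsκ, hy]
    simpa using hall (y - x)
  set j := (κ : Perm (ZMod (2 ^ v))) 0 with hjdef
  rcases affine_involution hv0 (u := u) (c := j) (fun x => by rw [← haff, ← haff, hinv])
    (fun x => by rw [← haff]; exact hfix x) with ⟨rfl, hc⟩ | ⟨rfl, hj⟩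
  · intro y x
    have := hsκ y x
    rwa [haff, haff, one_mul, one_mul, hc] at this
  · have hκj : ∀ x, (κ : Perm (ZMod (2 ^ v))) x = j - x := fun x => by rw [haff]; ring
    have hgj : ∀ g ∈ hs.permGroup, ∀ y, g (j - y) = j - g y := fun g hg' y => by
      rw [← hκj, hκ ⟨g, hg'⟩, hκj]
    obtain ⟨P, hP, ⟨b, hb⟩, hPmap⟩ := hs.exists_pairing hd hv h2 hgj
    have hhalf := hP.half hs hd hv hj (fun x => hgj _ (hg x ▸ (hs.toPerm (hs.gen x)).2)) hb
    exact hs.half_commutes_of_reflection hd hv hj hz hzh (fun g => hgj g g.2)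
      (fun g y => hP.unique _ _ _ (hhalf _).1 (hPmap g g.2 _ _ (hhalf y).1)) fun x => (hhalf x).2

end

end CycleSet

/-! ### Transport to `ZMod (2 ^ v)` along the cycle of the diagonal. -/

theorem mainTheorem3 {X : Type*} [Finite X] [CycleSet X] (v : ℕ) (hv : 2 < v)
    (hcard : Nat.card X = 2 ^ v)
    (hT : (CycleSet.diagonal X).IsCycleOn Set.univ) :
    CycleSet.IsRetractable X := by
  classical
  have hne : Nonempty X := (Nat.card_pos_iff.1 (hcard ▸ by positivity)).1
  obtain ⟨x₀⟩ := hne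
  have := Fintype.ofFinite X
  set T := CycleSet.diagonal X with hTdef
  have hTapp : ∀ x, T x = CycleSet.op x x := fun _ => rfl
  have hTu : T.IsCycleOn (Finset.univ : Finset X) := by rwa [Finset.coe_univ]
  have hcardu : (Finset.univ : Finset X).card = 2 ^ v := by
    rw [Finset.card_univ, ← Nat.card_eq_fintype_card, hcard]
  have hpow : ∀ a b : ℕ, (T ^ a) x₀ = (T ^ b) x₀ ↔ (a : ZMod (2 ^ v)) = b := by
    intro a b
    rw [hTu.pow_apply_eq_pow_apply (Finset.mem_univ x₀), hcardu, ZMod.natCast_eq_natCast_iff]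
  let f : ZMod (2 ^ v) → X := fun i => (T ^ i.val) x₀
  have hf : ∀ a : ℕ, f a = (T ^ a) x₀ := fun a => (hpow _ _).2 (ZMod.natCast_zmod_val _)
  have hinj : Function.Injective f := fun a b hab => by
    simpa [ZMod.natCast_zmod_val] using (hpow _ _).1 hab
  have hbij : Function.Bijective f :=
    (Nat.bijective_iff_injective_and_card f).2 ⟨hinj, by rw [Nat.card_zmod, hcard]⟩
  let φ : ZMod (2 ^ v) ≃ X := Equiv.ofBijective f hbij
  have hφ : ∀ i, φ (i + 1) = T (φ i) := by
    intro i
    change f (i + 1) = T ((T ^ i.val) x₀)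
    rw [← ZMod.natCast_zmod_val i, ← Nat.cast_succ, hf, ZMod.natCast_zmod_val, pow_succ']
    rfl
  let s : ZMod (2 ^ v) → Equiv.Perm (ZMod (2 ^ v)) := fun i =>
    (φ.trans (CycleSet.sigma (φ i))).trans φ.symm
  have hsapp : ∀ i k, φ (s i k) = CycleSet.op (φ i) (φ k) := fun i k =>
    φ.apply_symm_apply _
  have hs : CycleSet.IsCycloid s := by
    refine fun x y => Equiv.ext fun z => φ.injective ?_
    simp only [Equiv.Perm.mul_apply, hsapp]
    exact CycleSet.cycloid _ _ _
  have hd : ∀ i, s i i = i + 1 := fun i => φ.injective (by rw [hsapp, hφ, hTapp])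
  obtain ⟨x, y, hxy, h⟩ := hs.exists_eq_of_diag hd hv
  refine CycleSet.isRetractable_iff.2 ⟨φ x, φ y, φ.injective.ne hxy, fun z => ?_⟩
  obtain ⟨z, rfl⟩ := φ.surjective z
  rw [← hsapp, ← hsapp, h]
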